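/- Let $m$ be a positive integer, $\mu=(\mu_1,\dots,\mu_m)\in\mathbb{N}^m$ and $k=\mu_1+\dots+\mu_m$. Let $e_1,\dots,e_m$ be the standard basis of $L_0=\mathbb{C}[z]^m$, and for $p\in\mathbb{N}$ let $W_p\subset L_0$ be the span of the $z^a e_i$ with $a<p$, $1\le i\le m$. Let $\mathbb{X}$ be the space of $\mathbb{C}[z]$-submodules $L\subset L_0$ of finite codimension over $\mathbb{C}$, with the functor of points sending a commutative $\mathbb{C}$-algebra $R$ to the set of $R[z]$-submodules $L\subset R[z]^m$ whose quotient is a finitely generated projective $R$-module. Let $\mathbb{X}_\mu\subset\mathbb{X}$ be the locus of those $L$ for which (i) the classes $[z^a e_i]$ with $1\le i\le m$, $0\le a<\mu_i$, form a basis of $L_0/L$, and (ii) $z^{\mu_i}e_i\in W_{\mu_i}+L$ for all $i$ (for $R$-points: the same conditions with $R[z]^m$ in place of $L_0$ and $R$-linear bases and spans). Let $M_\mu$ be the variety of $k\times k$ block matrices $A=(A_{ij})_{1\le i,j\le m}$, where $A_{ij}$ has size $\mu_i\times\mu_j$, such that $A_{ii}$ has $1$s just below the diagonal and all its other non-zero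 entries in the last column, and $A_{ij}$ for $i\ne j$ has all its non-zero entries in the last column and none of them below row $\mu_j$. Then there is an isomorphism $\mathbb{X}_\mu\cong M_\mu$, natural on $R$-points for all commutative $\mathbb{C}$-algebras $R$, which sends $L$ to the matrix of multiplication by $z$ on $L_0/L$ in the basis of the $[z^a e_i]$ (ordered by $i$ and then by $a$). Moreover $M_\mu$ is isomorphic to the affine space $\mathbb{A}^{d}$ over $\mathbb{C}$ with $d=\sum_{i,j}\min(\mu_i,\mu_j)$. -/

import Mathlib

open CategoryTheory Polynomial TensorProduct

noncomputable section

namespace MV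

/-! ### Lattices in `R[z]^m` and their base change -/

section Algebra

variable {m : ℕ}

/-- The vector `z^a e_i` of `R[z]^m`. -/
def zvec (R : Type) [CommRing R] (i : Fin m) (a : ℕ) : Fin m → R[X] :=
  Pi.single i (X ^ a)

/-- The `R`-submodule `W_p` of `R[z]^m` spanned by the `z^a e_i` with `a < p`. -/
def W (R : Type) [CommRing R] (m p : ℕ) : Submodule R (Fin m → R[X]) :=
  Submodule.span R {v | ∃ (i : Fin m) (a : ℕ), a < p ∧ v = zvec R i a}

variable {R S : Type} [CommRing R] [CommRing S] [Algebra ℂ R] [Algebra ℂ S]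

/-- Coefficientwise application of `f : R → S` to a vector of `R[z]^m`. -/
def mapVec (f : R →ₐ[ℂ] S) (v : Fin m → R[X]) : Fin m → S[X] :=
  fun i => (v i).map f.toRingHom

/-- The base change of an `R[z]`-submodule `L` of `R[z]^m` along `f : R → S`: the `S[z]`-submodule
of `S[z]^m` generated by the image of `L`. -/
def pull (f : R →ₐ[ℂ] S) (L : Submodule R[X] (Fin m → R[X])) :
    Submodule S[X] (Fin m → S[X]) :=
  Submodule.span S[X] (mapVec f '' L)

/-- The quotient `L_0 / L`, where `L_0 = R[z]^m`. -/
abbrev Quo (L : Submodule R[X] (Fin m → R[X])) : Type := (Fin m → R[X]) ⧸ L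

/-- Multiplication by `z` on `L_0 / L`, as an `R`-linear map. -/
def mulZ (L : Submodule R[X] (Fin m → R[X])) : Quo L →ₗ[R] Quo L :=
  Algebra.lsmul R R (Quo L) (X : R[X])

/-- The index set of the pairs `(i, a)` with `a < μ_i`. -/
abbrev Idx (μ : Fin m → ℕ) : Type := (i : Fin m) × Fin (μ i)

/-- The classes `[z^a e_i]` in `L_0 / L`, for `a < μ_i`. -/
def cls (μ : Fin m → ℕ) (L : Submodule R[X] (Fin m → R[X])) (p : Idx μ) : Quo L :=
  Submodule.Quotient.mk (zvec R p.1 p.2)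

/-- The classes `[z^a e_i]`, `a < μ_i`, form a basis of `L_0 / L` over `R`, and
`z^{μ_i} e_i ∈ W_{μ_i} + L` for all `i`. -/
structure InLocus (μ : Fin m → ℕ) (L : Submodule R[X] (Fin m → R[X])) : Prop where
  linearIndependent : LinearIndependent R (cls μ L)
  span_eq_top : ⊤ ≤ Submodule.span R (Set.range (cls μ L))
  mem_sup : ∀ i : Fin m, zvec R i (μ i) ∈ W R m (μ i) ⊔ L.restrictScalars R

/-- The basis of `L_0 / L` consisting of the classes `[z^a e_i]`, `a < μ_i`. -/
def InLocus.basis {μ : Fin m → ℕ} {L : Submodule R[X] (Fin m → R[X])} (h : InLocus μ L) :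
    Module.Basis (Idx μ) R (Quo L) :=
  Module.Basis.mk h.linearIndependent h.span_eq_top

/-- The matrix of multiplication by `z` on `L_0 / L` in the basis of the classes `[z^a e_i]`. -/
def InLocus.zMatrix {μ : Fin m → ℕ} {L : Submodule R[X] (Fin m → R[X])} (h : InLocus μ L) :
    Matrix (Idx μ) (Idx μ) R :=
  LinearMap.toMatrix h.basis h.basis (mulZ L)

/-! Helper facts on base change. -/

lemma mapVec_add (f : R →ₐ[ℂ] S) (v w : Fin m → R[X]) :
    mapVec f (v + w) = mapVec f v + mapVec f w := by
  funext i; simp [mapVec]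

lemma mapVec_smul (f : R →ₐ[ℂ] S) (p : R[X]) (v : Fin m → R[X]) :
    mapVec f (p • v) = p.map f.toRingHom • mapVec f v := by
  funext i; simp [mapVec]

lemma mapVec_smul' (f : R →ₐ[ℂ] S) (r : R) (v : Fin m → R[X]) :
    mapVec f (r • v) = f r • mapVec f v := by
  funext i; simp [mapVec, Polynomial.map_smul]

lemma mapVec_zvec (f : R →ₐ[ℂ] S) (i : Fin m) (a : ℕ) :
    mapVec f (zvec R i a) = zvec S i a := by
  funext j
  by_cases h : j = i
  · subst h; simp [mapVec, zvec]
  · simp [mapVec, zvec, h]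

lemma pull_id (L : Submodule R[X] (Fin m → R[X])) : pull (AlgHom.id ℂ R) L = L := by
  have h : mapVec (m := m) (AlgHom.id ℂ R) = id := by
    funext v i
    exact Polynomial.map_id
  simp [pull, h]

lemma pull_comp {T : Type} [CommRing T] [Algebra ℂ T] (g : S →ₐ[ℂ] T) (f : R →ₐ[ℂ] S)
    (L : Submodule R[X] (Fin m → R[X])) : pull (g.comp f) L = pull g (pull f L) := by
  have hc : ∀ v : Fin m → R[X], mapVec (g.comp f) v = mapVec g (mapVec f v) := by
    intro v; funext i
    simp only [mapVec, Polynomial.map_map]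
    rfl
  apply le_antisymm
  · refine Submodule.span_le.2 ?_
    rintro _ ⟨v, hv, rfl⟩
    rw [hc]
    exact Submodule.subset_span ⟨_, Submodule.subset_span ⟨v, hv, rfl⟩, rfl⟩
  · refine Submodule.span_le.2 ?_
    rintro _ ⟨w, hw, rfl⟩
    change w ∈ Submodule.span _ _ at hw
    induction hw using Submodule.span_induction with
    | mem x hx =>
      obtain ⟨v, hv, rfl⟩ := hx
      exact Submodule.subset_span ⟨v, hv, hc v⟩
    | zero =>
      have : mapVec g (0 : Fin m → S[X]) = 0 := by funext i; simp [mapVec]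
      rw [this]; exact Submodule.zero_mem _
    | add x y _ _ hx hy => rw [mapVec_add]; exact Submodule.add_mem _ hx hy
    | smul p x _ hx => rw [mapVec_smul]; exact Submodule.smul_mem _ _ hx

/-- The monomial basis of `S[z]^m` over `S`. -/
def monoBasis (S : Type) [CommRing S] (m : ℕ) :
    Module.Basis ((_ : Fin m) × ℕ) S (Fin m → S[X]) :=
  Pi.basis fun _ => Polynomial.basisMonomials S

lemma monoBasis_apply (i : Fin m) (a : ℕ) : monoBasis S m ⟨i, a⟩ = zvec S i a := by
  simp [monoBasis, zvec, Pi.basis_apply, Polynomial.X_pow_eq_monomial]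

lemma monoBasis_induction {P : (Fin m → R[X]) → Prop} (hz : ∀ i a, P (zvec R i a))
    (h0 : P 0) (ha : ∀ v w, P v → P w → P (v + w)) (hs : ∀ (r : R) v, P v → P (r • v))
    (v : Fin m → R[X]) : P v := by
  have hv : v ∈ Submodule.span R (Set.range (monoBasis R m)) := by
    rw [(monoBasis R m).span_eq]; trivial
  induction hv using Submodule.span_induction with
  | mem x hx =>
    obtain ⟨⟨i, a⟩, rfl⟩ := hx
    rw [monoBasis_apply]; exact hz i a
  | zero => exact h0
  | add x y _ _ hx hy => exact ha _ _ hx hy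
  | smul r x _ hx => exact hs _ _ hx

lemma exists_equiv (f : R →ₐ[ℂ] S) (L : Submodule R[X] (Fin m → R[X])) :
    letI := f.toRingHom.toAlgebra
    ∃ e : (S ⊗[R] Quo L) ≃ₗ[S] Quo (pull f L),
      ∀ v, e (1 ⊗ₜ Submodule.Quotient.mk v) = Submodule.Quotient.mk (mapVec f v) := by
  let _ := f.toRingHom.toAlgebra
  have halg : ∀ r : R, algebraMap R S r = f r := fun _ => rfl
  -- the map from left to right
  let g₀ : (Fin m → R[X]) →ₗ[R] Quo (pull f L) :=
    { toFun := fun v => Submodule.Quotient.mk (mapVec f v)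
      map_add' := fun v w => by rw [mapVec_add]; rfl
      map_smul' := fun r v => by
        rw [mapVec_smul', ← halg r]
        simp only [RingHom.id_apply, Submodule.Quotient.mk_smul, algebraMap_smul] }
  let g₁ : Quo L →ₗ[R] Quo (pull f L) :=
    { toFun := fun q => Quotient.liftOn' q g₀ (by
        intro v w hvw
        have h : v - w ∈ L := (Submodule.quotientRel_def L).1 hvw
        rw [← sub_eq_zero, ← map_sub]
        exact (Submodule.Quotient.mk_eq_zero _).2 (Submodule.subset_span ⟨_, h, rfl⟩))
      map_add' := by
        rintro ⟨v⟩ ⟨w⟩; exact g₀.map_add v w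
      map_smul' := by
        rintro r ⟨v⟩; exact g₀.map_smul r v }
  let g : (S ⊗[R] Quo L) →ₗ[S] Quo (pull f L) := g₁.liftBaseChange S
  have hg : ∀ v, g (1 ⊗ₜ Submodule.Quotient.mk v) = Submodule.Quotient.mk (mapVec f v) := by
    intro v
    have : g (1 ⊗ₜ Submodule.Quotient.mk v) = (1 : S) • g₁ (Submodule.Quotient.mk v) := by
      simp [g]
    rw [this, one_smul]; rfl
  -- the map from right to left
  let h₀ : (Fin m → S[X]) →ₗ[S] (S ⊗[R] Quo L) :=
    (monoBasis S m).constr S fun p => 1 ⊗ₜ Submodule.Quotient.mk (zvec R p.1 p.2)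
  have hh₀ : ∀ v, h₀ (mapVec f v) = 1 ⊗ₜ Submodule.Quotient.mk v := by
    intro v
    induction v using monoBasis_induction with
    | hz i a =>
      rw [mapVec_zvec, ← monoBasis_apply]
      simp only [h₀, Module.Basis.constr_basis]
    | h0 =>
      have : mapVec f (0 : Fin m → R[X]) = 0 := by funext i; simp [mapVec]
      rw [this, map_zero, Submodule.Quotient.mk_zero, TensorProduct.tmul_zero]
    | ha v w hv hw =>
      rw [mapVec_add, map_add, hv, hw, Submodule.Quotient.mk_add, TensorProduct.tmul_add]
    | hs r v hv =>
      rw [mapVec_smul', map_smul, hv, Submodule.Quotient.mk_smul, TensorProduct.tmul_smul,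
        ← halg, algebraMap_smul]
  have hX : ∀ (p : S[X]) (v : Fin m → R[X]), v ∈ L → h₀ (p • mapVec f v) = 0 := by
    intro p v hv
    induction p using Polynomial.induction_on' with
    | add p q hp hq => rw [add_smul, map_add, hp, hq, add_zero]
    | monomial n s =>
      have : (Polynomial.monomial n s : S[X]) • mapVec f v
          = s • mapVec f ((X ^ n : R[X]) • v) := by
        rw [mapVec_smul, ← Polynomial.smul_X_eq_monomial, smul_assoc]
        simp
      rw [this, map_smul, hh₀, (Submodule.Quotient.mk_eq_zero L).2 (L.smul_mem _ hv),
        TensorProduct.tmul_zero, smul_zero]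
  have hker : ∀ w ∈ pull f L, h₀ w = 0 := by
    intro w hw
    have key : ∀ p : S[X], h₀ (p • w) = 0 := by
      unfold pull at hw
      induction hw using Submodule.span_induction with
      | mem x hx =>
        obtain ⟨v, hv, rfl⟩ := hx
        exact fun p => hX p v hv
      | zero => intro p; rw [smul_zero, map_zero]
      | add x y _ _ hx hy => intro p; rw [smul_add, map_add, hx, hy, add_zero]
      | smul q x _ hx => intro p; rw [← mul_smul]; exact hx _
    simpa using key 1
  let h : Quo (pull f L) →ₗ[S] (S ⊗[R] Quo L) :=
    { toFun := fun q => Quotient.liftOn' q h₀ (by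
        intro v w hvw
        have h : v - w ∈ pull f L := (Submodule.quotientRel_def _).1 hvw
        rw [← sub_eq_zero, ← map_sub]
        exact hker _ h)
      map_add' := by
        rintro ⟨v⟩ ⟨w⟩; exact h₀.map_add v w
      map_smul' := by
        rintro r ⟨v⟩; exact h₀.map_smul r v }
  have hh : ∀ w, h (Submodule.Quotient.mk w) = h₀ w := fun _ => rfl
  have h1 : ∀ x, h (g x) = x := by
    intro x
    induction x using TensorProduct.induction_on with
    | zero => simp
    | add x y hx hy => rw [map_add, map_add, hx, hy]
    | tmul s q =>
      obtain ⟨v, rfl⟩ := Submodule.Quotient.mk_surjective L q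
      have : s ⊗ₜ[R] (Submodule.Quotient.mk v : Quo L) = s • (1 ⊗ₜ[R] Submodule.Quotient.mk v) := by
        rw [TensorProduct.smul_tmul', smul_eq_mul, mul_one]
      rw [this, map_smul, map_smul, hg, hh, hh₀]
  have h2 : ∀ y, g (h y) = y := by
    intro y
    obtain ⟨w, rfl⟩ := Submodule.Quotient.mk_surjective _ y
    rw [hh]
    induction w using monoBasis_induction with
    | hz i a => rw [← mapVec_zvec f, hh₀, hg]
    | h0 => simp
    | ha v w hv hw => rw [map_add, map_add, hv, hw, Submodule.Quotient.mk_add]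
    | hs r v hv => rw [map_smul, map_smul, hv, Submodule.Quotient.mk_smul]
  exact ⟨LinearEquiv.ofLinearMap g h (LinearMap.ext h2) (LinearMap.ext h1), hg⟩

lemma pull_finite_projective (f : R →ₐ[ℂ] S) (L : Submodule R[X] (Fin m → R[X]))
    (h : Module.Finite R (Quo L) ∧ Module.Projective R (Quo L)) :
    Module.Finite S (Quo (pull f L)) ∧ Module.Projective S (Quo (pull f L)) := by
  letI := f.toRingHom.toAlgebra
  obtain ⟨e, -⟩ := exists_equiv f L
  haveI := h.1
  haveI := h.2
  exact ⟨Module.Finite.equiv e, Module.Projective.of_equiv e⟩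

lemma InLocus.pull {μ : Fin m → ℕ} (f : R →ₐ[ℂ] S) {L : Submodule R[X] (Fin m → R[X])}
    (h : InLocus μ L) : InLocus μ (pull f L) := by
  letI := f.toRingHom.toAlgebra
  obtain ⟨e, he⟩ := exists_equiv f L
  let b : Module.Basis (Idx μ) S (Quo (MV.pull f L)) := (h.basis.baseChange S).map e
  have hb : ⇑b = cls μ (MV.pull f L) := by
    funext p
    have : h.basis p = Submodule.Quotient.mk (zvec R p.1 p.2) := by
      simp [InLocus.basis, cls]
    simp only [b, Module.Basis.map_apply, Module.Basis.baseChange_apply, this, he, mapVec_zvec,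
      cls]
  refine ⟨hb ▸ b.linearIndependent, hb ▸ b.span_eq.ge, fun i => ?_⟩
  obtain ⟨w, hw, l, hl, hwl⟩ := Submodule.mem_sup.1 (h.mem_sup i)
  rw [← mapVec_zvec f, ← hwl, mapVec_add]
  refine Submodule.add_mem_sup ?_ (Submodule.subset_span ⟨l, hl, rfl⟩)
  unfold W at hw
  clear hwl
  induction hw using Submodule.span_induction with
  | mem x hx =>
    obtain ⟨j, a, ha, rfl⟩ := hx
    rw [mapVec_zvec]
    exact Submodule.subset_span ⟨j, a, ha, rfl⟩
  | zero =>
    have : mapVec f (0 : Fin m → R[X]) = 0 := by funext i; simp [mapVec]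
    rw [this]; exact Submodule.zero_mem _
  | add x y _ _ hx hy => rw [mapVec_add]; exact Submodule.add_mem _ hx hy
  | smul r x _ hx => rw [mapVec_smul']; exact Submodule.smul_mem _ _ hx

end Algebra

/-! ### The varieties, through their functors of points on commutative `ℂ`-algebras

An isomorphism of varieties (schemes) over `ℂ` is the same as an isomorphism of their functors of
points on commutative `ℂ`-algebras. -/

/-- The space `𝕏` of lattices of finite codimension in `L_0`. Its `R`-points are the
`R[z]`-submodules `L` of `R[z]^m` for which `L_0 / L` is a finitely generated projective `R`-module;
for `R = ℂ` these are the `z`-stable complex subspaces of finite codimension in `ℂ[z]^m`. -/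
def Lattices (m : ℕ) : CommAlgCat.{0} ℂ ⥤ Type where
  obj R := {L : Submodule R[X] (Fin m → R[X]) //
    Module.Finite R (Quo L) ∧ Module.Projective R (Quo L)}
  map f := ↾fun L => ⟨pull f.hom L.1, pull_finite_projective f.hom L.1 L.2⟩
  map_id R := by
    apply ConcreteCategory.hom_ext
    intro L
    exact Subtype.ext (pull_id L.1)
  map_comp f g := by
    apply ConcreteCategory.hom_ext
    intro L
    exact Subtype.ext (pull_comp g.hom f.hom L.1)

/-- The locus `𝕏_μ` in `𝕏`: the lattices `L` such that the `[z^a e_i]`, `a < μ_i`, form a basis of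
`L_0 / L` and `z^{μ_i} e_i ∈ W_{μ_i} + L` for all `i`. -/
def Locus {m : ℕ} (μ : Fin m → ℕ) : Subfunctor (Lattices m) where
  obj _ := {L | InLocus μ L.1}
  map f _ hL := InLocus.pull f.hom hL

/-- The shape of the matrices of `M_μ`, with rows and columns of each block counted from `0`: the
entry of the block `(i, j)` in row `a` and column `b` is
* in a column other than the last one: `1` just below the diagonal if `i = j`, and `0` elsewhere;
* in the last column: `0` unless `a < μ_j`, and arbitrary if `a < μ_j`. -/
structure HasShape {m : ℕ} (μ : Fin m → ℕ) {R : Type} [CommRing R]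
    (A : Matrix (Idx μ) (Idx μ) R) : Prop where
  diag : ∀ (i : Fin m) (a b : Fin (μ i)), (b : ℕ) + 1 < μ i →
    A ⟨i, a⟩ ⟨i, b⟩ = if (a : ℕ) = b + 1 then 1 else 0
  offDiag : ∀ (i j : Fin m), i ≠ j → ∀ (a : Fin (μ i)) (b : Fin (μ j)), (b : ℕ) + 1 < μ j →
    A ⟨i, a⟩ ⟨j, b⟩ = 0
  offDiag_last : ∀ (i j : Fin m), i ≠ j → ∀ (a : Fin (μ i)) (b : Fin (μ j)), (b : ℕ) + 1 = μ j →
    μ j ≤ (a : ℕ) → A ⟨i, a⟩ ⟨j, b⟩ = 0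

/-- The variety `M_μ`, whose `R`-points are the block matrices over `R` of the above shape. -/
def Mats {m : ℕ} (μ : Fin m → ℕ) : CommAlgCat.{0} ℂ ⥤ Type where
  obj R := {A : Matrix (Idx μ) (Idx μ) R // HasShape μ A}
  map f := ↾fun A => ⟨A.1.map f.hom, by
    obtain ⟨A, h1, h2, h3⟩ := A
    refine ⟨fun i a b hb => ?_, fun i j hij a b hb => ?_, fun i j hij a b hb hab => ?_⟩
    · simp only [Matrix.map_apply, h1 i a b hb]
      split_ifs <;> simp
    · simp only [Matrix.map_apply, h2 i j hij a b hb, map_zero]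
    · simp only [Matrix.map_apply, h3 i j hij a b hb hab, map_zero]⟩
  map_id R := by
    ext A
    rfl
  map_comp f g := by
    ext A
    rfl

/-- The affine space `𝔸^d` over `ℂ`, whose `R`-points are the `ℂ`-algebra homomorphisms
`ℂ[x_1, …, x_d] → R`. -/
def AffSpace (d : ℕ) : CommAlgCat.{0} ℂ ⥤ Type :=
  coyoneda.obj (Opposite.op (CommAlgCat.of ℂ (MvPolynomial (Fin d) ℂ)))

end MV

end

open CategoryTheory Polynomial

noncomputable section

namespace MV

section Points

variable {m : ℕ} {μ : Fin m → ℕ} {R : Type} [CommRing R]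

/-! For `L` in the locus, `z · z^b e_j` is the next basis vector when `b + 1 < μ_j`, which fixes
every column but the last of each block. Condition (ii) bounds the last column, once
`mk_mem_span_cls` shows that `W_p` modulo `L` is spanned by the basis classes of degree less than
`p`.

Conversely, a matrix `A` of this shape makes `R^k` an `R[z]`-module, and sending `e_i` to the head
of block `i` gives the `z`-linear map `evalVec A`. By the shape, `z^a e_i` goes to the standard
basis vector `(i, a)` (`HasShape.evalVec_zvec`), so the kernel `latticeOf A` lies in the locus.
Starting from `L`, coordinates on `L_0 / L` and `evalVec h.zMatrix` agree on the `e_i` and with the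
action of `z`, so the kernel is `L` again. Naturality holds because the matrix is determined by
relations in `L`, which survive base change.

The free entries of block `(i, j)` lie in its last column, in rows `a < min(μ_i, μ_j)`; they are the
affine coordinates. -/

lemma X_pow_smul_zvec (i : Fin m) (a n : ℕ) :
    (X ^ n : R[X]) • zvec R i a = zvec R i (n + a) := by
  simp only [zvec, ← Pi.single_smul, smul_eq_mul, pow_add]

lemma X_smul_zvec (i : Fin m) (a : ℕ) : (X : R[X]) • zvec R i a = zvec R i (a + 1) := by
  simpa [add_comm] using X_pow_smul_zvec (R := R) i a 1

lemma X_pow_smul_mem_W {p : ℕ} (n : ℕ) {v : Fin m → R[X]} (hv : v ∈ W R m p) :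
    (X ^ n : R[X]) • v ∈ W R m (n + p) := by
  unfold W at hv
  induction hv using Submodule.span_induction with
  | mem x hx =>
    obtain ⟨i, a, ha, rfl⟩ := hx
    rw [X_pow_smul_zvec]
    exact Submodule.subset_span ⟨i, n + a, by omega, rfl⟩
  | zero => rw [smul_zero]; exact Submodule.zero_mem _
  | add x y _ _ hx hy => rw [smul_add]; exact Submodule.add_mem _ hx hy
  | smul r x _ hx => rw [smul_comm]; exact Submodule.smul_mem _ _ hx

/-! ### The matrix of a lattice in the locus -/

namespace InLocus

variable {L : Submodule R[X] (Fin m → R[X])}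

lemma mk_sum_smul {ι : Type*} [Fintype ι] (c : ι → R) (v : ι → Fin m → R[X]) :
    (Submodule.Quotient.mk (∑ p, c p • v p) : Quo L) = ∑ p, c p • Submodule.Quotient.mk (v p) := by
  exact (map_sum (L.mkQ.restrictScalars R) (fun p => c p • v p) Finset.univ).trans
    (Finset.sum_congr rfl fun p _ => map_smul (L.mkQ.restrictScalars R) (c p) (v p))

@[simp] lemma basis_apply (h : InLocus μ L) (p : Idx μ) : h.basis p = cls μ L p := by
  simp [InLocus.basis]

/-- `W_p` also contains `z^a e_i` with `μ_i ≤ a < p`, which are not basis vectors. Condition (ii)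
trades each for an element of `W_a`, with `a < p`, so strong induction on `p` applies. -/
lemma mk_mem_span_cls (h : InLocus μ L) (p : ℕ) {v : Fin m → R[X]} (hv : v ∈ W R m p) :
    (Submodule.Quotient.mk v : Quo L) ∈
      Submodule.span R (cls μ L '' {q : Idx μ | (q.2 : ℕ) < p}) := by
  induction p using Nat.strong_induction_on generalizing v with
  | _ p ih =>
    unfold W at hv
    induction hv using Submodule.span_induction with
    | mem x hx =>
      obtain ⟨i, a, ha, rfl⟩ := hx
      by_cases hai : a < μ i
      · exact Submodule.subset_span ⟨⟨i, ⟨a, hai⟩⟩, ha, rfl⟩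
      -- Condition (ii) for `i`, multiplied by `z^(a - μ_i)`, puts `z^a e_i` in `W_a + L`.
      · obtain ⟨w, hw, l, hl, hwl⟩ := Submodule.mem_sup.1 (h.mem_sup i)
        have hz : zvec R i a = (X ^ (a - μ i) : R[X]) • w + (X ^ (a - μ i) : R[X]) • l := by
          rw [← smul_add, hwl, X_pow_smul_zvec]
          congr 1
          omega
        have hl0 : (Submodule.Quotient.mk ((X ^ (a - μ i) : R[X]) • l) : Quo L) = 0 :=
          (Submodule.Quotient.mk_eq_zero L).2 (L.smul_mem _ hl)
        rw [hz, Submodule.Quotient.mk_add, hl0, add_zero]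
        have hw' := X_pow_smul_mem_W (a - μ i) hw
        rw [Nat.sub_add_cancel (not_lt.1 hai)] at hw'
        refine Submodule.span_mono ?_ (ih a ha hw')
        exact Set.image_mono fun q (hq : (q.2 : ℕ) < a) => hq.trans ha
    | zero => rw [Submodule.Quotient.mk_zero]; exact Submodule.zero_mem _
    | add x y _ _ hx hy => rw [Submodule.Quotient.mk_add]; exact Submodule.add_mem _ hx hy
    | smul r x _ hx => rw [Submodule.Quotient.mk_smul]; exact Submodule.smul_mem _ _ hx

lemma zMatrix_apply (h : InLocus μ L) (p q : Idx μ) :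
    h.zMatrix p q = h.basis.repr (Submodule.Quotient.mk (zvec R q.1 (q.2 + 1))) p := by
  rw [zMatrix, LinearMap.toMatrix_apply, basis_apply, ← X_smul_zvec]
  rfl

lemma hasShape_zMatrix (h : InLocus μ L) : HasShape μ h.zMatrix := by
  have hsucc : ∀ (p : Idx μ) (j : Fin m) (b : Fin (μ j)) (hb : (b : ℕ) + 1 < μ j),
      h.zMatrix p ⟨j, b⟩ = Finsupp.single (⟨j, ⟨b + 1, hb⟩⟩ : Idx μ) (1 : R) p := by
    intro p j b hb
    rw [zMatrix_apply, ← h.basis.repr_self, basis_apply]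
    rfl
  refine ⟨fun i a b hb => ?_, fun i j hij a b hb => ?_, fun i j hij a b hb hab => ?_⟩
  · rw [hsucc _ _ _ hb, Finsupp.single_apply]
    simp [Fin.ext_iff, eq_comm]
  · rw [hsucc _ _ _ hb, Finsupp.single_apply, if_neg]
    intro e
    exact hij (congrArg Sigma.fst e).symm
  · obtain ⟨w, hw, l, hl, hwl⟩ := Submodule.mem_sup.1 (h.mem_sup j)
    have hl0 : (Submodule.Quotient.mk l : Quo L) = 0 := (Submodule.Quotient.mk_eq_zero L).2 hl
    have hspan := h.mk_mem_span_cls _ hw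
    rw [zMatrix_apply]
    simp only [hb, ← hwl, Submodule.Quotient.mk_add, hl0, add_zero]
    have hcls : cls μ L = h.basis := funext fun p => (h.basis_apply p).symm
    rw [hcls, h.basis.mem_span_image] at hspan
    by_contra hne
    -- A nonzero coordinate at row `a` would force `a < μ_j`.
    have := hspan (Finsupp.mem_support_iff.2 hne)
    exact absurd this (not_lt.2 hab)

/-- The matrix of multiplication by `z` is determined by the relations
`z · z^b e_j ≡ ∑ A_{(i,a),(j,b)} z^a e_i` modulo `L`. -/
lemma sub_sum_zMatrix_mem (h : InLocus μ L) (q : Idx μ) :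
    zvec R q.1 (q.2 + 1) - ∑ p : Idx μ, h.zMatrix p q • zvec R p.1 p.2 ∈ L := by
  rw [← Submodule.Quotient.eq, mk_sum_smul]
  conv_lhs => rw [← h.basis.sum_repr (Submodule.Quotient.mk (zvec R q.1 (q.2 + 1)))]
  refine Finset.sum_congr rfl fun p _ => ?_
  rw [← zMatrix_apply, basis_apply]
  rfl

/-- Serves twice: for compatibility with base change, and to recover `A` from `latticeOf A`. -/
lemma zMatrix_eq (h : InLocus μ L) {A : Matrix (Idx μ) (Idx μ) R}
    (hA : ∀ q : Idx μ, zvec R q.1 (q.2 + 1) - ∑ p : Idx μ, A p q • zvec R p.1 p.2 ∈ L) :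
    h.zMatrix = A := by
  ext p q
  have e : (Submodule.Quotient.mk (zvec R q.1 (q.2 + 1)) : Quo L) =
      ∑ p : Idx μ, A p q • h.basis p := by
    rw [(Submodule.Quotient.eq L).2 (hA q), mk_sum_smul]
    exact Finset.sum_congr rfl fun p _ => by rw [basis_apply, cls]
  rw [zMatrix_apply, e, h.basis.repr_sum_self]

lemma zMatrix_pull {S : Type} [CommRing S] [Algebra ℂ R] [Algebra ℂ S] (f : R →ₐ[ℂ] S) (h : InLocus μ L) :
    (h.pull f).zMatrix = h.zMatrix.map f := by
  apply zMatrix_eq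
  intro q
  have key : mapVec f (zvec R q.1 (q.2 + 1) - ∑ p : Idx μ, h.zMatrix p q • zvec R p.1 p.2) =
      zvec S q.1 (q.2 + 1) - ∑ p : Idx μ, h.zMatrix.map f p q • zvec S p.1 p.2 := by
    let F : (Fin m → R[X]) →+ (Fin m → S[X]) := AddMonoidHom.mk' (mapVec f) (mapVec_add f)
    have hF : ∀ v, mapVec f v = F v := fun _ => rfl
    rw [hF, map_sub, map_sum]
    simp only [← hF, mapVec_smul', mapVec_zvec, Matrix.map_apply]
  rw [← key]
  exact Submodule.subset_span ⟨_, h.sub_sum_zMatrix_mem q, rfl⟩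

end InLocus

/-! ### The lattice of a matrix -/

/-- The vector `e_{(i,0)}` of `R^k`, or `0` if the `i`-th block is empty. -/
def blockHead (R : Type) [CommRing R] (μ : Fin m → ℕ) (i : Fin m) : Idx μ → R :=
  if h : 0 < μ i then Pi.single ⟨i, ⟨0, h⟩⟩ 1 else 0

/-- The map `R[z]^m → R^k` which sends `e_i` to the head of the `i`-th block, where `z` acts on
`R^k` through `A`. -/
def evalVec (A : Matrix (Idx μ) (Idx μ) R) : (Fin m → R[X]) →ₗ[R] (Idx μ → R) where
  toFun v := ∑ i, (aeval A (v i)).mulVec (blockHead R μ i)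
  map_add' v w := by simp [Matrix.add_mulVec, Finset.sum_add_distrib]
  map_smul' r v := by simp [Matrix.smul_mulVec, Finset.smul_sum]

lemma evalVec_smul (A : Matrix (Idx μ) (Idx μ) R) (p : R[X]) (v : Fin m → R[X]) :
    evalVec A (p • v) = (aeval A p).mulVec (evalVec A v) := by
  simp [evalVec, Matrix.mulVec_sum, Matrix.mulVec_mulVec]

lemma evalVec_zvec_zero (A : Matrix (Idx μ) (Idx μ) R) (i : Fin m) :
    evalVec A (zvec R i 0) = blockHead R μ i := by
  simp only [evalVec, LinearMap.coe_mk, AddHom.coe_mk, zvec, pow_zero]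
  rw [Finset.sum_eq_single i]
  · simp
  · intro j _ hj
    simp [hj]
  · simp

lemma evalVec_zvec_succ (A : Matrix (Idx μ) (Idx μ) R) (i : Fin m) (a : ℕ) :
    evalVec A (zvec R i (a + 1)) = A.mulVec (evalVec A (zvec R i a)) := by
  rw [← X_smul_zvec, evalVec_smul, aeval_X]

/-- Induction on the degree: a column that is not last in its block is the standard basis vector one
row further down the diagonal block. -/
lemma HasShape.evalVec_zvec {A : Matrix (Idx μ) (Idx μ) R} (hA : HasShape μ A) (q : Idx μ) :
    evalVec A (zvec R q.1 q.2) = Pi.single q 1 := by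
  obtain ⟨i, a, ha⟩ := q
  induction a with
  | zero => simp only [evalVec_zvec_zero, blockHead, dif_pos ha]
  | succ a ih =>
    rw [evalVec_zvec_succ, ih (by omega), Matrix.mulVec_single_one]
    funext ⟨j, c⟩
    rw [Matrix.col_apply, Pi.single_apply]
    by_cases hij : j = i
    · subst hij
      rw [hA.diag j c ⟨a, by omega⟩ ha]
      simp [Fin.ext_iff]
    · rw [hA.offDiag j i hij c ⟨a, by omega⟩ ha, if_neg]
      intro e
      exact hij (congrArg Sigma.fst e)

lemma HasShape.evalVec_zvec_add_one {A : Matrix (Idx μ) (Idx μ) R} (hA : HasShape μ A)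
    (q : Idx μ) : evalVec A (zvec R q.1 (q.2 + 1)) = A.col q := by
  rw [evalVec_zvec_succ, hA.evalVec_zvec, Matrix.mulVec_single_one]

/-- The lattice of a matrix: the kernel of `evalVec`. -/
def latticeOf (A : Matrix (Idx μ) (Idx μ) R) : Submodule R[X] (Fin m → R[X]) where
  carrier := {v | evalVec A v = 0}
  zero_mem' := map_zero _
  add_mem' {v w} hv hw := by
    simp only [Set.mem_ofPred_eq] at hv hw ⊢
    rw [map_add, hv, hw, add_zero]
  smul_mem' p v hv := by
    simp only [Set.mem_ofPred_eq] at hv ⊢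
    rw [evalVec_smul, hv, Matrix.mulVec_zero]

lemma mem_latticeOf {A : Matrix (Idx μ) (Idx μ) R} {v : Fin m → R[X]} :
    v ∈ latticeOf A ↔ evalVec A v = 0 := Iff.rfl

/-- A lattice of the locus is the lattice of its matrix of multiplication by `z`. -/
lemma InLocus.latticeOf_zMatrix [Algebra ℂ R] {L : Submodule R[X] (Fin m → R[X])} (h : InLocus μ L) :
    latticeOf h.zMatrix = L := by
  have hX : ∀ v, h.basis.equivFun (Submodule.Quotient.mk ((X : R[X]) • v)) =
      h.zMatrix.mulVec (h.basis.equivFun (Submodule.Quotient.mk v)) := by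
    intro v
    exact (LinearMap.toMatrix_mulVec_repr h.basis h.basis (mulZ L) (Submodule.Quotient.mk v)).symm
  -- Both sides are `R`-linear and turn `z` into `h.zMatrix`, so they need only be compared on the
  -- `e_i`.
  have key : ∀ v, h.basis.equivFun (Submodule.Quotient.mk v) = evalVec h.zMatrix v := by
    intro v
    induction v using monoBasis_induction with
    | hz i a =>
      induction a with
      | zero =>
        rw [evalVec_zvec_zero, blockHead]
        split_ifs with hi
        · have : (Submodule.Quotient.mk (zvec R i 0) : Quo L) = h.basis ⟨i, ⟨0, hi⟩⟩ := by
            rw [h.basis_apply]; rfl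
          rw [this]
          funext j
          rw [h.basis.equivFun_self]
          simp [Pi.single_apply, eq_comm]
        -- For an empty block, `W_0 = 0` and (ii) says `e_i ∈ L`, matching the value `0` of
        -- `blockHead`.
        · have hi0 : μ i = 0 := by omega
          have hW : W R m 0 = ⊥ := by simp [W]
          have := h.mem_sup i
          rw [hi0, hW, bot_sup_eq] at this
          rw [(Submodule.Quotient.mk_eq_zero L).2 this, map_zero]
      | succ a ih => rw [evalVec_zvec_succ, ← X_smul_zvec, hX, ih]
    | h0 => simp
    | ha v w hv hw => rw [Submodule.Quotient.mk_add, map_add, map_add, hv, hw]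
    | hs r v hv => rw [Submodule.Quotient.mk_smul, map_smul, map_smul, hv]
  ext v
  rw [mem_latticeOf, ← key, LinearEquiv.map_eq_zero_iff, Submodule.Quotient.mk_eq_zero]

namespace HasShape

variable {A : Matrix (Idx μ) (Idx μ) R}

lemma evalVec_sum (hA : HasShape μ A) (c : Idx μ → R) :
    evalVec A (∑ p : Idx μ, c p • zvec R p.1 p.2) = c := by
  simp only [map_sum, map_smul, hA.evalVec_zvec]
  exact (pi_eq_sum_univ' c).symm

lemma exists_quo_equiv (hA : HasShape μ A) :
    ∃ e : Quo (latticeOf A) ≃ₗ[R] (Idx μ → R), ∀ v, e (Submodule.Quotient.mk v) = evalVec A v := by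
  let K := (latticeOf A).restrictScalars R
  have hK : K = LinearMap.ker (evalVec A) := rfl
  have hsurj : Function.Surjective (evalVec A) := fun c => ⟨_, hA.evalVec_sum c⟩
  let e₁ : Quo (latticeOf A) ≃ₗ[R] (_ ⧸ K) :=
    (Submodule.Quotient.restrictScalarsEquiv R (latticeOf A)).symm
  let e₂ : (_ ⧸ K) ≃ₗ[R] (Idx μ → R) :=
    (Submodule.quotEquivOfEq _ _ hK).trans ((evalVec A).quotKerEquivOfSurjective hsurj)
  exact ⟨e₁.trans e₂, fun v => rfl⟩

lemma finite_projective (hA : HasShape μ A) :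
    Module.Finite R (Quo (latticeOf A)) ∧ Module.Projective R (Quo (latticeOf A)) := by
  obtain ⟨e, -⟩ := hA.exists_quo_equiv
  exact ⟨Module.Finite.equiv e.symm, Module.Projective.of_equiv e.symm⟩

lemma sub_sum_mem_latticeOf (hA : HasShape μ A) (q : Idx μ) :
    zvec R q.1 (q.2 + 1) - ∑ p : Idx μ, A p q • zvec R p.1 p.2 ∈ latticeOf A := by
  rw [mem_latticeOf, map_sub, hA.evalVec_zvec_add_one, hA.evalVec_sum fun p => A p q, sub_eq_zero]
  rfl

lemma inLocus_latticeOf (hA : HasShape μ A) : InLocus μ (latticeOf A) := by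
  obtain ⟨e, he⟩ := hA.exists_quo_equiv
  let b : Module.Basis (Idx μ) R (Quo (latticeOf A)) := (Pi.basisFun R (Idx μ)).map e.symm
  have hb : ⇑b = cls μ (latticeOf A) := by
    funext p
    rw [Module.Basis.map_apply, LinearEquiv.symm_apply_eq, cls, he, hA.evalVec_zvec,
      Pi.basisFun_apply]
  refine ⟨hb ▸ b.linearIndependent, hb ▸ b.span_eq.ge, fun i => ?_⟩
  rcases Nat.eq_zero_or_pos (μ i) with h0 | hpos
  · refine Submodule.mem_sup_right ?_
    change _ ∈ latticeOf A
    rw [mem_latticeOf, h0, evalVec_zvec_zero, blockHead, dif_neg (by omega)]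
  · let q : Idx μ := ⟨i, ⟨μ i - 1, by omega⟩⟩
    have hq : (q.2 : ℕ) + 1 = μ i := Nat.sub_add_cancel hpos
    have hmem := hA.sub_sum_mem_latticeOf q
    rw [hq] at hmem
    rw [← add_sub_cancel (∑ p : Idx μ, A p q • zvec R p.1 p.2) (zvec R i (μ i))]
    refine Submodule.add_mem_sup (Submodule.sum_mem _ fun p _ => ?_) hmem
    by_cases hp : (p.2 : ℕ) < μ i
    · exact Submodule.smul_mem _ _ (Submodule.subset_span ⟨p.1, p.2, hp, rfl⟩)
    -- A row index `a ≥ μ_i` cannot occur in the diagonal block, so the shape makes this coefficient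
    -- vanish.
    · obtain ⟨j, a⟩ := p
      have hji : j ≠ i := by
        rintro rfl
        exact hp a.2
      rw [hA.offDiag_last j i hji a q.2 hq (not_lt.1 hp), zero_smul]
      exact Submodule.zero_mem _

end HasShape

/-! ### Free entries as affine coordinates -/

/-- The index set of the free entries of the matrices of `M_μ`. -/
abbrev FreeIdx (μ : Fin m → ℕ) : Type :=
  (i : Fin m) × (j : Fin m) × Fin (min (μ i) (μ j))

lemma card_freeIdx (μ : Fin m → ℕ) :
    Fintype.card (FreeIdx μ) = ∑ i, ∑ j, min (μ i) (μ j) := by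
  simp [Fintype.card_sigma]

/-- The matrix of `M_μ` with prescribed free entries. -/
def ofEntries (c : FreeIdx μ → R) : Matrix (Idx μ) (Idx μ) R := fun p q =>
  if (q.2 : ℕ) + 1 = μ q.1 then
    if h : (p.2 : ℕ) < μ q.1 then c ⟨p.1, q.1, ⟨p.2, lt_min p.2.2 h⟩⟩ else 0
  else if p.1 = q.1 ∧ (p.2 : ℕ) = q.2 + 1 then 1 else 0

/-- The position of a free entry: in the last column of its block. -/
def FreeIdx.last (x : FreeIdx μ) : Idx μ :=
  ⟨x.2.1, ⟨μ x.2.1 - 1, by have := lt_min_iff.1 x.2.2.2; omega⟩⟩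

/-- The row of a free entry. -/
def FreeIdx.row (x : FreeIdx μ) : Idx μ :=
  ⟨x.1, ⟨x.2.2, (lt_min_iff.1 x.2.2.2).1⟩⟩

lemma hasShape_ofEntries (c : FreeIdx μ → R) : HasShape μ (ofEntries c) := by
  refine ⟨fun i a b hb => ?_, fun i j hij a b hb => ?_, fun i j hij a b hb hab => ?_⟩
  · simp [ofEntries, hb.ne]
  · simp [ofEntries, hb.ne, hij]
  · simp [ofEntries, hb, hab]

/-- The matrices of `M_μ` are parametrized by their free entries. -/
def entriesEquiv (μ : Fin m → ℕ) (R : Type) [CommRing R] :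
    {A : Matrix (Idx μ) (Idx μ) R // HasShape μ A} ≃ (FreeIdx μ → R) where
  toFun A x := A.1 x.row x.last
  invFun c := ⟨ofEntries c, hasShape_ofEntries c⟩
  left_inv := by
    rintro ⟨A, hA⟩
    apply Subtype.ext
    ext ⟨i, a⟩ ⟨j, b⟩
    simp only [ofEntries]
    split_ifs with hb ha hab
    · have : (⟨μ j - 1, by omega⟩ : Fin (μ j)) = b := Fin.ext (by simp only; omega)
      simp only [FreeIdx.row, FreeIdx.last, this]
    · have hij : i ≠ j := by
        rintro rfl
        exact ha a.2
      exact (hA.offDiag_last i j hij a b hb (not_lt.1 ha)).symm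
    · obtain ⟨rfl, hab⟩ := hab
      rw [hA.diag i a b (by omega), if_pos hab]
    · by_cases hij : i = j
      · subst hij
        rw [hA.diag i a b (by omega), if_neg fun h => hab ⟨rfl, h⟩]
      · exact (hA.offDiag i j hij a b (by omega)).symm
  right_inv c := by
    funext ⟨i, j, a, ha⟩
    have ha' := lt_min_iff.1 ha
    -- A free entry has `a < μ_j`, so `μ_j > 0` and the truncated subtraction is exact.
    have h1 : μ j - 1 + 1 = μ j := by omega
    simp [ofEntries, FreeIdx.row, FreeIdx.last, h1, ha'.2]

end Points

/-! ### The natural isomorphisms -/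

/-- The isomorphism `𝕏_μ ≅ M_μ`, through the matrix of multiplication by `z`. -/
def locusIso {m : ℕ} (μ : Fin m → ℕ) : (Locus μ).toFunctor ≅ Mats μ :=
  NatIso.ofComponents
    (fun R => Equiv.toIso
      { toFun := fun L => ⟨InLocus.zMatrix L.2, InLocus.hasShape_zMatrix L.2⟩
        invFun := fun A => ⟨⟨latticeOf A.1, A.2.finite_projective⟩, A.2.inLocus_latticeOf⟩
        left_inv := fun L => Subtype.ext (Subtype.ext (InLocus.latticeOf_zMatrix L.2))
        right_inv := fun A => Subtype.ext
          (A.2.inLocus_latticeOf.zMatrix_eq A.2.sub_sum_mem_latticeOf) })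
    (fun f => by
      apply ConcreteCategory.hom_ext
      intro L
      exact Subtype.ext (InLocus.zMatrix_pull f.hom L.2))

/-- An enumeration of the free entries. -/
def enumFree {m : ℕ} (μ : Fin m → ℕ) : Fin (∑ i, ∑ j, min (μ i) (μ j)) ≃ FreeIdx μ :=
  (Fintype.equivFinOfCardEq (card_freeIdx μ)).symm

/-- The `R`-points of `M_μ` are the algebra homomorphisms from the polynomial ring in its free
entries to `R`. -/
def matsPointsEquiv {m : ℕ} (μ : Fin m → ℕ) (R : CommAlgCat.{0} ℂ) :
    {A : Matrix (Idx μ) (Idx μ) R // HasShape μ A} ≃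
      (CommAlgCat.of ℂ (MvPolynomial (Fin (∑ i, ∑ j, min (μ i) (μ j))) ℂ) ⟶ R) where
  toFun A := CommAlgCat.ofHom (MvPolynomial.aeval fun n => entriesEquiv μ R A (enumFree μ n))
  invFun φ := (entriesEquiv μ R).symm fun x => φ.hom (MvPolynomial.X ((enumFree μ).symm x))
  left_inv A := by
    rw [Equiv.symm_apply_eq]
    funext x
    simp
  right_inv φ := by
    apply CommAlgCat.hom_ext
    apply MvPolynomial.algHom_ext
    intro n
    simp

/-- The isomorphism `M_μ ≅ 𝔸^d`. -/
def matsIso {m : ℕ} (μ : Fin m → ℕ) : Mats μ ≅ AffSpace (∑ i, ∑ j, min (μ i) (μ j)) :=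
  NatIso.ofComponents (fun R => Equiv.toIso (matsPointsEquiv μ R)) (fun f => by
    apply ConcreteCategory.hom_ext
    intro A
    apply CommAlgCat.hom_ext
    apply MvPolynomial.algHom_ext
    intro n
    change MvPolynomial.aeval _ (MvPolynomial.X n) =
      f.hom (MvPolynomial.aeval _ (MvPolynomial.X n))
    rw [MvPolynomial.aeval_X, MvPolynomial.aeval_X]
    rfl)

end MV

end

theorem theorem3 {m : ℕ} (μ : Fin m → ℕ) :
    (∃ Φ : (MV.Locus μ).toFunctor ≅ MV.Mats μ,
      ∀ (R : CommAlgCat.{0} ℂ) (L : (MV.Locus μ).toFunctor.obj R),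
        (Φ.hom.app R L).1 = MV.InLocus.zMatrix L.2) ∧
    Nonempty (MV.Mats μ ≅ MV.AffSpace (∑ i, ∑ j, min (μ i) (μ j))) :=
  ⟨⟨MV.locusIso μ, fun _ _ => rfl⟩, ⟨MV.matsIso μ⟩⟩
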